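/- For a field $K$ with (possibly trivial) involution $a\mapsto\bar a$, let $L_0(K)$ be the Witt group of non-singular hermitian forms over $K$. Here a form is a finite-dimensional $K$-vector space $V$ with a pairing $\theta:V\times V\to K$ that is conjugate linear in the first variable and linear in the second and satisfies $\theta(a,b)=\overline{\theta(b,a)}$; it is non-singular if $a\mapsto\theta(a,\cdot)$ is a bijection $V\to\mathrm{Hom}_K(V,K)$. $L_0(K)$ is the group of isometry classes of such forms under orthogonal direct sum, modulo the congruence generated by setting to zero every form that vanishes on a subspace of half the dimension. Put $\tilde L_0(K):=L_0(K)\otimes_{\mathbb Z}\mathbb Q$. Let $\bar{\mathbb Q}\subset\mathbb C$ be the algebraic closure of $\mathbb Q$ in $\mathbb C$. Equip $\mathbb C$ with complex conjugation, and $\bar{\mathbb Q}(t)$ with the involution given by complex conjugation on $\bar{\mathbb Q}$ and $\bar t=t^{-1}$. For $z\in S^1=\{z\in\mathbb C:|z|=1\}$ transcendental over $\mathbb Q$, the evaluation $f(t)\mapsto f(z)$ is a homomorphism $\bar{\mathbb Q}(t)\to\mathbb C$ of fields with involution. Extension of scalars along it, $(V,\theta)\mapsto(\mathbb C\otimes_{\bar{\mathbb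 Q}(t)}V,\ (c\otimes v,d\otimes w)\mapsto \bar c\,\theta(v,w)(z)\,d)$, induces a homomorphism $\tilde L_0(\bar{\mathbb Q}(t))\to\tilde L_0(\mathbb C)$, written $\tau\mapsto\tau(z)$. Theorem. Let $\tau\in\tilde L_0(\bar{\mathbb Q}(t))$. Then $\tau=0$ in $\tilde L_0(\bar{\mathbb Q}(t))$ if and only if $\tau(z)=0$ in $\tilde L_0(\mathbb C)$ for all transcendental $z\in S^1$. -/

import Mathlib

open scoped TensorProduct

universe u

set_option linter.unusedSectionVars false

noncomputable section

namespace HermWitt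

/-- A non-singular hermitian form over a field `K` with (possibly trivial) involution: a finite
dimensional vector space `V` with a pairing `θ : V × V → K`, conjugate linear in the first and
linear in the second variable, such that `θ(a, b)` is the conjugate of `θ(b, a)`, and such that
`a ↦ θ(a, ·)` is a bijection from `V` onto `Hom(V, K)`. -/
structure HermForm (K : Type u) [Field K] [StarRing K] where
  V : Type u
  [addCommGroup : AddCommGroup V]
  [module : Module K V]
  [finite : Module.Finite K V]
  θ : V →ₗ⋆[K] V →ₗ[K] K
  herm : ∀ a b, θ a b = star (θ b a)
  nonsing : Function.Bijective θ

attribute [instance] HermForm.addCommGroup HermForm.module HermForm.finite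

namespace HermForm

section

variable {K : Type u} [Field K] [StarRing K]

/-- Isometry of hermitian forms. -/
def Isometric (A B : HermForm K) : Prop :=
  ∃ e : A.V ≃ₗ[K] B.V, ∀ a b, B.θ (e a) (e b) = A.θ a b

theorem Isometric.refl (A : HermForm K) : Isometric A A :=
  ⟨LinearEquiv.refl K A.V, fun _ _ => rfl⟩

theorem Isometric.symm {A B : HermForm K} : Isometric A B → Isometric B A := by
  rintro ⟨e, he⟩
  exact ⟨e.symm, fun a b => by rw [← he]; simp⟩

theorem Isometric.trans {A B C : HermForm K} :
    Isometric A B → Isometric B C → Isometric A C := by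
  rintro ⟨e, he⟩ ⟨f, hf⟩
  exact ⟨e.trans f, fun a b => by simp [he, hf]⟩

instance setoid (K : Type u) [Field K] [StarRing K] : Setoid (HermForm K) :=
  ⟨Isometric, Isometric.refl, Isometric.symm, Isometric.trans⟩

/-- A form is metabolic if it vanishes on a subspace of half the dimension. -/
def IsMetabolic (A : HermForm K) : Prop :=
  ∃ P : Submodule K A.V,
    2 * Module.finrank K P = Module.finrank K A.V ∧ ∀ a ∈ P, ∀ b ∈ P, A.θ a b = 0

/-- The form on the zero space. -/
abbrev zeroForm (K : Type u) [Field K] [StarRing K] : HermForm K where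
  V := PUnit
  θ := 0
  herm _ _ := by simp
  nonsing := ⟨fun _ _ _ => Subsingleton.elim _ _, fun f => ⟨0, by
    ext x; exact (map_zero f).symm⟩⟩

/-- The orthogonal direct sum. -/
abbrev sum (A B : HermForm K) : HermForm K where
  V := A.V × B.V
  θ := LinearMap.mk₂'ₛₗ (starRingEnd K) (RingHom.id K)
    (fun x y => A.θ x.1 y.1 + B.θ x.2 y.2)
    (fun x x' y => by simp only [Prod.fst_add, Prod.snd_add, map_add, LinearMap.add_apply]; ring)
    (fun c x y => by simp [mul_add])
    (fun x y y' => by simp only [Prod.fst_add, Prod.snd_add, map_add]; ring)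
    (fun c x y => by simp [mul_add])
  herm a b := by
    simp only [LinearMap.mk₂'ₛₗ_apply, star_add]
    rw [A.herm, B.herm]
  nonsing := by
    constructor
    · intro x y h
      have h' := fun z => LinearMap.congr_fun h z
      refine Prod.ext (A.nonsing.1 (LinearMap.ext fun a => ?_))
        (B.nonsing.1 (LinearMap.ext fun b => ?_))
      · simpa using h' (a, 0)
      · simpa using h' (0, b)
    · intro f
      obtain ⟨a, ha⟩ := A.nonsing.2 (f.comp (LinearMap.inl K A.V B.V))
      obtain ⟨b, hb⟩ := B.nonsing.2 (f.comp (LinearMap.inr K A.V B.V))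
      refine ⟨(a, b), LinearMap.ext fun z => ?_⟩
      simp only [LinearMap.mk₂'ₛₗ_apply, ha, hb, LinearMap.comp_apply, LinearMap.inl_apply,
        LinearMap.inr_apply, ← map_add]
      simp

@[simp] theorem sum_apply (A B : HermForm K) (x y : A.V × B.V) :
    (A.sum B).θ x y = A.θ x.1 y.1 + B.θ x.2 y.2 := rfl

/-- The form `(V, -θ)`. -/
abbrev neg (A : HermForm K) : HermForm K where
  V := A.V
  θ := -A.θ
  herm a b := by simp only [LinearMap.neg_apply, star_neg, A.herm a b]
  nonsing := by
    have h : (⇑(-A.θ) : A.V → _) = (fun f => -f) ∘ A.θ := rfl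
    rw [h]
    exact (Equiv.neg _).bijective.comp A.nonsing

@[simp] theorem neg_apply (A : HermForm K) (x y : A.V) : A.neg.θ x y = -A.θ x y := rfl

theorem sum_congr {A A' B B' : HermForm K} :
    Isometric A A' → Isometric B B' → Isometric (A.sum B) (A'.sum B') := by
  rintro ⟨e, he⟩ ⟨f, hf⟩
  refine ⟨(e.prodCongr f : (A.V × B.V) ≃ₗ[K] (A'.V × B'.V)), fun a b => ?_⟩
  change A'.θ (e a.1) (e b.1) + B'.θ (f a.2) (f b.2) = A.θ a.1 b.1 + B.θ a.2 b.2
  rw [he, hf]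

theorem sum_comm' (A B : HermForm K) : Isometric (A.sum B) (B.sum A) :=
  ⟨LinearEquiv.prodComm K A.V B.V, fun a b => by
    change B.θ a.2 b.2 + A.θ a.1 b.1 = A.θ a.1 b.1 + B.θ a.2 b.2
    ring⟩

theorem sum_assoc' (A B C : HermForm K) :
    Isometric ((A.sum B).sum C) (A.sum (B.sum C)) :=
  ⟨LinearEquiv.prodAssoc K A.V B.V C.V, fun a b => by
    change A.θ a.1.1 b.1.1 + (B.θ a.1.2 b.1.2 + C.θ a.2 b.2)
      = A.θ a.1.1 b.1.1 + B.θ a.1.2 b.1.2 + C.θ a.2 b.2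
    ring⟩

theorem sum_zero' (A : HermForm K) : Isometric (A.sum (zeroForm K)) A :=
  ⟨(LinearEquiv.prodUnique : (A.V × PUnit.{u + 1}) ≃ₗ[K] A.V), fun a b => by
    change A.θ a.1 b.1 = A.θ a.1 b.1 + 0
    rw [add_zero]⟩

theorem neg_congr {A B : HermForm K} : Isometric A B → Isometric A.neg B.neg := by
  rintro ⟨e, he⟩
  refine ⟨(e : A.V ≃ₗ[K] B.V), fun a b => ?_⟩
  exact congrArg Neg.neg (he a b)

theorem neg_sum_self_isMetabolic (A : HermForm K) : (A.neg.sum A).IsMetabolic := by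
  refine ⟨(LinearMap.range (LinearMap.prod LinearMap.id LinearMap.id :
    A.V →ₗ[K] A.V × A.V) : Submodule K (A.V × A.V)), ?_, ?_⟩
  · rw [LinearMap.finrank_range_of_inj]
    · change _ = Module.finrank K (A.V × A.V)
      rw [Module.finrank_prod, two_mul]
    · intro x y h
      exact congrArg Prod.fst h
  · rintro _ ⟨a, rfl⟩ _ ⟨b, rfl⟩
    change -A.θ a b + A.θ a b = 0
    simp

theorem neg_isMetabolic {A : HermForm K} : A.IsMetabolic → A.neg.IsMetabolic := by
  rintro ⟨P, h, hP⟩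
  exact ⟨P, h, fun a ha b hb => by
    change -A.θ a b = 0
    rw [hP a ha b hb, neg_zero]⟩

end

end HermForm

open HermForm

/-- The set of isometry classes of non-singular hermitian forms over `K`. -/
def FormClass (K : Type u) [Field K] [StarRing K] : Type (u + 1) := Quotient (HermForm.setoid K)

namespace FormClass

variable {K : Type u} [Field K] [StarRing K]

/-- The isometry class of a form. -/
def mk (A : HermForm K) : FormClass K := Quotient.mk _ A

/-- The orthogonal direct sum of isometry classes. -/
def add : FormClass K → FormClass K → FormClass K :=
  Quotient.map₂ HermForm.sum fun _ _ h _ _ h' => sum_congr h h'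

/-- Isometry classes form a commutative monoid under orthogonal direct sum. -/
instance : AddCommMonoid (FormClass K) where
  nsmul n x := @nsmulRec _ ⟨mk (zeroForm K)⟩ ⟨add⟩ n x
  add := add
  zero := mk (zeroForm K)
  add_assoc := by
    rintro ⟨A⟩ ⟨B⟩ ⟨C⟩
    exact Quotient.sound (sum_assoc' A B C)
  add_comm := by
    rintro ⟨A⟩ ⟨B⟩
    exact Quotient.sound (sum_comm' A B)
  add_zero := by
    rintro ⟨A⟩
    exact Quotient.sound (sum_zero' A)
  zero_add := by
    rintro ⟨A⟩
    exact Quotient.sound ((sum_comm' _ _).trans (sum_zero' A))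

theorem mk_add (A B : HermForm K) : mk A + mk B = mk (A.sum B) := rfl

end FormClass

section Witt

variable (K : Type u) [Field K] [StarRing K]

/-- The relation setting every metabolic form to zero. -/
def metabolicRel (x y : FormClass K) : Prop :=
  (∃ A : HermForm K, A.IsMetabolic ∧ x = FormClass.mk A) ∧ y = 0

/-- The Witt group `L₀(K)` of non-singular hermitian forms over `K`: isometry classes under direct
sum, modulo the smallest congruence for which all metabolic forms are equivalent to zero. -/
def L0 : Type (u + 1) := (addConGen (metabolicRel K)).Quotient

instance : AddCommMonoid (L0 K) :=
  inferInstanceAs (AddCommMonoid (addConGen (metabolicRel K)).Quotient)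

/-- The projection from isometry classes to Witt classes. -/
def L0.proj : FormClass K →+ L0 K := (addConGen (metabolicRel K)).mk'

end Witt

namespace L0

variable {K : Type u} [Field K] [StarRing K]

/-- The Witt class `[(V, θ)]`. -/
def mk (A : HermForm K) : L0 K := proj K (FormClass.mk A)

theorem mk_add (A B : HermForm K) : mk A + mk B = mk (A.sum B) :=
  ((proj K).map_add _ _).symm

theorem mk_eq_zero {A : HermForm K} (h : A.IsMetabolic) : mk A = 0 :=
  (AddCon.eq _).2 (AddConGen.Rel.of _ _ ⟨⟨A, h, rfl⟩, rfl⟩)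

theorem mk_congr {A B : HermForm K} (h : Isometric A B) : mk A = mk B :=
  congrArg (proj K) (Quotient.sound h)

theorem mk_surjective : Function.Surjective (mk (K := K)) := by
  rintro ⟨⟨A⟩⟩
  exact ⟨A, rfl⟩

/-- Additive functions of forms which are invariant under isometry and vanish on metabolic forms
are defined on the Witt group. -/
def lift {N : Type*} [AddCommMonoid N] (f : HermForm K → N)
    (hc : ∀ A B, Isometric A B → f A = f B) (ha : ∀ A B, f (A.sum B) = f A + f B)
    (h0 : f (zeroForm K) = 0) (hm : ∀ A : HermForm K, A.IsMetabolic → f A = 0) : L0 K →+ N :=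
  AddCon.lift _
    { toFun := Quotient.lift f hc
      map_zero' := h0
      map_add' := by
        rintro ⟨A⟩ ⟨B⟩
        exact ha A B }
    (AddCon.addConGen_le.2 (by
      rintro _ _ ⟨⟨A, hA, rfl⟩, rfl⟩
      exact (hm A hA).trans h0.symm))

theorem lift_mk {N : Type*} [AddCommMonoid N] (f : HermForm K → N)
    (hc : ∀ A B, Isometric A B → f A = f B) (ha : ∀ A B, f (A.sum B) = f A + f B)
    (h0 : f (zeroForm K) = 0) (hm : ∀ A : HermForm K, A.IsMetabolic → f A = 0)
    (A : HermForm K) : lift f hc ha h0 hm (mk A) = f A := rfl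

theorem mk_zeroForm : mk (zeroForm K) = 0 := (proj K).map_zero

/-- `[(V, θ)] ↦ [(V, -θ)]`. -/
def negHom : L0 K →+ L0 K :=
  lift (fun A => mk A.neg) (fun _ _ h => mk_congr (neg_congr h))
    (fun A B => by
      rw [mk_add]
      refine mk_congr ⟨LinearEquiv.refl K (A.V × B.V), fun a b => ?_⟩
      change -A.θ a.1 b.1 + -B.θ a.2 b.2 = -(A.θ a.1 b.1 + B.θ a.2 b.2)
      ring)
    (by
      rw [← mk_zeroForm]
      refine mk_congr ⟨LinearEquiv.refl K PUnit.{u + 1}, fun a b => ?_⟩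
      change (0 : K) = -0
      simp)
    (fun _ h => mk_eq_zero (neg_isMetabolic h))

instance : Neg (L0 K) := ⟨negHom⟩

instance : AddCommGroup (L0 K) where
  __ := (inferInstance : AddCommMonoid (L0 K))
  zsmul := zsmulRec
  neg_add_cancel x := by
    obtain ⟨A, rfl⟩ := mk_surjective x
    exact (mk_add A.neg A).trans (mk_eq_zero A.neg_sum_self_isMetabolic)

end L0

/-- `L₀(K) ⊗ ℚ`. -/
abbrev L0Q (K : Type u) [Field K] [StarRing K] : Type (u + 1) := L0 K ⊗[ℤ] ℚ

section BaseChange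

variable {K : Type u} [Field K] [StarRing K]
  (L : Type u) [Field L] [StarRing L] [Algebra K L]

theorem star_algebraMap' [StarModule K L] (a : K) :
    algebraMap K L (star a) = star (algebraMap K L a) := by
  rw [Algebra.algebraMap_eq_smul_one, Algebra.algebraMap_eq_smul_one, star_smul, star_one]

section Pairing

variable {V W : Type u} [AddCommGroup V] [Module K V] [AddCommGroup W] [Module K W]

/-- The functional `d ⊗ w ↦ d θ(v, w)` on `L ⊗ V`. -/
def rightMap (θ : V →ₗ⋆[K] V →ₗ[K] K) (v : V) : (L ⊗[K] V) →ₗ[L] L :=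
  ((Algebra.linearMap K L).comp (θ v)).liftBaseChange L

@[simp] theorem rightMap_tmul (θ : V →ₗ⋆[K] V →ₗ[K] K) (v w : V) (d : L) :
    rightMap L θ v (d ⊗ₜ w) = d * algebraMap K L (θ v w) := by
  simp [rightMap]

variable [StarModule K L]

/-- The map `c ⊗ v ↦ (d ⊗ w ↦ c̄ d θ(v, w))`, as an additive map. -/
def baseChangeAux (θ : V →ₗ⋆[K] V →ₗ[K] K) : (L ⊗[K] V) →+ ((L ⊗[K] V) →ₗ[L] L) :=
  TensorProduct.liftAddHom
    { toFun := fun c =>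
        { toFun := fun v => star c • rightMap L θ v
          map_zero' := by ext; simp
          map_add' := fun v v' => by ext; simp [mul_add] }
      map_zero' := by ext; simp
      map_add' := fun c c' => by ext; simp [add_mul] }
    (fun r c v => by
      ext w
      simp only [AddMonoidHom.coe_mk, ZeroHom.coe_mk, LinearMap.smul_apply, rightMap_tmul,
        TensorProduct.AlgebraTensorModule.curry_apply, TensorProduct.curry_apply,
        LinearMap.map_smulₛₗ, starRingEnd_apply, smul_eq_mul, Algebra.smul_def, star_mul',
        map_mul, star_algebraMap', LinearMap.coe_restrictScalars]
      ring)

theorem baseChangeAux_tmul (θ : V →ₗ⋆[K] V →ₗ[K] K) (c d : L) (v w : V) :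
    baseChangeAux L θ (c ⊗ₜ v) (d ⊗ₜ w) = star c * d * algebraMap K L (θ v w) := by
  change (star c • rightMap L θ v) (d ⊗ₜ w) = _
  rw [LinearMap.smul_apply, rightMap_tmul, smul_eq_mul, mul_assoc]

/-- The sesquilinear pairing `(c ⊗ v, d ⊗ w) ↦ c̄ θ(v, w) d` on `L ⊗ V`. -/
def baseChangePairing (θ : V →ₗ⋆[K] V →ₗ[K] K) :
    (L ⊗[K] V) →ₗ⋆[L] (L ⊗[K] V) →ₗ[L] L where
  toFun := baseChangeAux L θ
  map_add' := map_add _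
  map_smul' c x := by
    induction x with
    | zero => simp
    | add x y hx hy => rw [smul_add, map_add, hx, hy, map_add, smul_add]
    | tmul d v =>
      ext w
      simp [TensorProduct.smul_tmul', baseChangeAux_tmul, mul_assoc, starRingEnd_apply]

theorem baseChangePairing_tmul (θ : V →ₗ⋆[K] V →ₗ[K] K) (c d : L) (v w : V) :
    baseChangePairing L θ (c ⊗ₜ v) (d ⊗ₜ w) = star c * d * algebraMap K L (θ v w) :=
  baseChangeAux_tmul L θ c d v w

theorem baseChangePairing_herm (θ : V →ₗ⋆[K] V →ₗ[K] K) (h : ∀ a b, θ a b = star (θ b a))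
    (x y : L ⊗[K] V) : baseChangePairing L θ x y = star (baseChangePairing L θ y x) := by
  induction x with
  | zero => simp
  | add x x' hx hx' => rw [map_add, LinearMap.add_apply, hx, hx', map_add, star_add]
  | tmul c v =>
    induction y with
    | zero => simp
    | add y y' hy hy' => rw [map_add, hy, hy', map_add, LinearMap.add_apply, star_add]
    | tmul d w =>
      rw [baseChangePairing_tmul, baseChangePairing_tmul, h v w, star_algebraMap']
      simp only [star_mul', star_star]
      ring

theorem baseChangePairing_bijective [Module.Finite K V] (θ : V →ₗ⋆[K] V →ₗ[K] K)
    (h : ∀ a b, θ a b = star (θ b a)) (hbij : Function.Bijective θ) :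
    Function.Bijective (baseChangePairing L θ) := by
  classical
  let b := Module.finBasis K V
  choose b' hb' using fun i => hbij.2 (b.coord i)
  have hpair : ∀ i j, θ (b' i) (b j) = if i = j then 1 else 0 := by
    intro i j
    rw [hb', Module.Basis.coord_apply, Module.Basis.repr_self, Finsupp.single_apply]
    simp only [eq_comm]
  let B := b.baseChange L
  have key : ∀ i (x : L ⊗[K] V), baseChangePairing L θ (1 ⊗ₜ b' i) x = B.repr x i := by
    intro i x
    have : baseChangePairing L θ (1 ⊗ₜ b' i) = B.coord i := by
      refine B.ext fun j => ?_
      rw [Module.Basis.coord_apply, Module.Basis.repr_self, show B j = 1 ⊗ₜ b j from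
        Module.Basis.baseChange_apply L b j, baseChangePairing_tmul, hpair, Finsupp.single_apply]
      by_cases h : i = j
      · simp [h]
      · simp [h, Ne.symm h]
    rw [this, Module.Basis.coord_apply]
  constructor
  · rw [injective_iff_map_eq_zero]
    intro x hx
    apply B.repr.injective
    ext i
    rw [← key, baseChangePairing_herm L θ h, hx]
    simp
  · intro f
    refine ⟨∑ i, star (f (B i)) • (1 ⊗ₜ[K] b' i : L ⊗[K] V), B.ext fun j => ?_⟩
    simp only [map_sum, LinearMap.sum_apply, LinearMap.map_smulₛₗ, LinearMap.smul_apply, key,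
      Module.Basis.repr_self, starRingEnd_apply, star_star, smul_eq_mul]
    rw [Finset.sum_eq_single j]
    · simp
    · intro i _ hij
      simp [Ne.symm hij]
    · simp

theorem baseChangePairing_map {θ : V →ₗ⋆[K] V →ₗ[K] K} {θ' : W →ₗ⋆[K] W →ₗ[K] K}
    (e : V →ₗ[K] W) (he : ∀ a b, θ' (e a) (e b) = θ a b) (x y : L ⊗[K] V) :
    baseChangePairing L θ' (e.baseChange L x) (e.baseChange L y)
      = baseChangePairing L θ x y := by
  induction x with
  | zero => simp
  | add x x' hx hx' => simp only [map_add, LinearMap.add_apply, hx, hx']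
  | tmul c v =>
    induction y with
    | zero => simp
    | add y y' hy hy' => simp only [map_add, hy, hy']
    | tmul d w => simp [baseChangePairing_tmul, he]

theorem baseChangePairing_prod {θ : V →ₗ⋆[K] V →ₗ[K] K} {θ' : W →ₗ⋆[K] W →ₗ[K] K}
    {ψ : (V × W) →ₗ⋆[K] (V × W) →ₗ[K] K} (h : ∀ a b, ψ a b = θ a.1 b.1 + θ' a.2 b.2)
    (x y : L ⊗[K] (V × W)) :
    baseChangePairing L θ (TensorProduct.prodRight K L L V W x).1
        (TensorProduct.prodRight K L L V W y).1
      + baseChangePairing L θ' (TensorProduct.prodRight K L L V W x).2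
        (TensorProduct.prodRight K L L V W y).2
      = baseChangePairing L ψ x y := by
  induction x with
  | zero => simp
  | add x x' hx hx' =>
    simp only [map_add, Prod.fst_add, Prod.snd_add, LinearMap.add_apply, ← hx, ← hx']
    ring
  | tmul c v =>
    induction y with
    | zero => simp
    | add y y' hy hy' =>
      simp only [map_add, Prod.fst_add, Prod.snd_add, ← hy, ← hy']
      ring
    | tmul d w =>
      rw [TensorProduct.prodRight_tmul, TensorProduct.prodRight_tmul]
      simp only [baseChangePairing_tmul, h, map_add]
      ring

theorem baseChangePairing_eq_zero {θ : V →ₗ⋆[K] V →ₗ[K] K} {P : Submodule K V}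
    (hP : ∀ a ∈ P, ∀ b ∈ P, θ a b = 0) :
    ∀ x ∈ P.baseChange L, ∀ y ∈ P.baseChange L, baseChangePairing L θ x y = 0 := by
  rintro _ ⟨x, rfl⟩ _ ⟨y, rfl⟩
  induction x with
  | zero => simp
  | add x x' hx hx' => simp only [map_add, LinearMap.add_apply, hx, hx', add_zero]
  | tmul c v =>
    induction y with
    | zero => simp
    | add y y' hy hy' => simp only [map_add, hy, hy', add_zero]
    | tmul d w => simp [baseChangePairing_tmul, hP v v.2 w w.2]

end Pairing

namespace HermForm

variable [StarModule K L]

/-- Extension of scalars of a hermitian form along a homomorphism of fields with involution: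
`L ⊗ V` with the pairing `(c ⊗ v, d ⊗ w) ↦ c̄ θ(v, w) d`. -/
abbrev baseChange (A : HermForm K) : HermForm L where
  V := L ⊗[K] A.V
  θ := baseChangePairing L A.θ
  herm := baseChangePairing_herm L A.θ A.herm
  nonsing := baseChangePairing_bijective L A.θ A.herm A.nonsing

theorem baseChange_congr {A B : HermForm K} (h : Isometric A B) :
    Isometric (A.baseChange L) (B.baseChange L) := by
  obtain ⟨e, he⟩ := h
  exact ⟨e.baseChange K L A.V B.V, fun x y => baseChangePairing_map L e.toLinearMap he x y⟩

theorem baseChange_sum (A B : HermForm K) :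
    Isometric ((A.sum B).baseChange L) ((A.baseChange L).sum (B.baseChange L)) :=
  ⟨TensorProduct.prodRight K L L A.V B.V,
    fun x y => baseChangePairing_prod L (sum_apply A B) x y⟩

theorem baseChange_zero : Isometric ((zeroForm K).baseChange L) (zeroForm L) := by
  have : Subsingleton (L ⊗[K] PUnit.{u + 1}) := inferInstance
  refine ⟨(0 : (L ⊗[K] PUnit.{u + 1}) ≃ₗ[L] PUnit.{u + 1}), fun x y => ?_⟩
  have hx : x = 0 := this.elim _ _
  subst hx
  simp

theorem baseChange_isMetabolic {A : HermForm K} (h : A.IsMetabolic) :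
    (A.baseChange L).IsMetabolic := by
  obtain ⟨P, hd, hP⟩ := h
  refine ⟨P.baseChange L, ?_, baseChangePairing_eq_zero L hP⟩
  have hinj : Function.Injective (P.subtype.baseChange L) :=
    Module.Flat.lTensor_preserves_injective_linearMap (M := L) P.subtype P.subtype_injective
  rw [Module.finrank_baseChange, ← hd, Submodule.baseChange,
    LinearMap.finrank_range_of_inj hinj, Module.finrank_baseChange]

end HermForm

variable [StarModule K L]

/-- The map `L₀(K) → L₀(L)` induced by extension of scalars. -/
def L0.baseChange : L0 K →+ L0 L :=
  L0.lift (fun A => L0.mk (A.baseChange L)) (fun _ _ h => L0.mk_congr (baseChange_congr L h))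
    (fun A B => by rw [L0.mk_add]; exact L0.mk_congr (baseChange_sum L A B))
    (by rw [← L0.mk_zeroForm]; exact L0.mk_congr (baseChange_zero L))
    (fun _ h => L0.mk_eq_zero (baseChange_isMetabolic L h))

end BaseChange

section RatFunc

variable {F : Type u} [Field F] [StarRing F]

theorem transcendental_X_inv : Transcendental F (RatFunc.X⁻¹ : RatFunc F) := by
  intro h
  exact RatFunc.transcendental_X (by simpa using h.inv)

/-- The ring homomorphism `F[t] → F(t)`, `∑ aᵢ tⁱ ↦ ∑ āᵢ t⁻ⁱ`. -/
def polyConj (F : Type u) [Field F] [StarRing F] : Polynomial F →+* RatFunc F :=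
  (Polynomial.aeval (RatFunc.X⁻¹ : RatFunc F)).toRingHom.comp
    (Polynomial.mapRingHom (starRingEnd F))

theorem polyConj_injective : Function.Injective (polyConj F) :=
  (transcendental_iff_injective.1 transcendental_X_inv).comp
    (Polynomial.map_injective _ (starRingEnd F).injective)

/-- The involution of `F(t)`: the given involution on `F`, and `t ↦ t⁻¹`. -/
def ratConj (F : Type u) [Field F] [StarRing F] : RatFunc F →+* RatFunc F :=
  RatFunc.liftRingHom (polyConj F)
    (nonZeroDivisors_le_comap_nonZeroDivisors_of_injective _ polyConj_injective)

theorem ratConj_C (a : F) : ratConj F (RatFunc.C a) = RatFunc.C (star a) := by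
  rw [ratConj, RatFunc.liftRingHom_C]
  simp [polyConj, starRingEnd_apply]

theorem ratConj_X : ratConj F RatFunc.X = RatFunc.X⁻¹ := by
  rw [ratConj, RatFunc.liftRingHom_X]
  simp [polyConj]

theorem ratFunc_hom_ext {L : Type*} [Field L] {f g : RatFunc F →+* L}
    (hC : ∀ a, f (RatFunc.C a) = g (RatFunc.C a)) (hX : f RatFunc.X = g RatFunc.X) : f = g := by
  refine IsLocalization.ringHom_ext (nonZeroDivisors (Polynomial F))
    (Polynomial.ringHom_ext (fun a => ?_) ?_)
  · simpa using hC a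
  · simpa using hX

instance : StarRing (RatFunc F) where
  star := ratConj F
  star_involutive x := by
    have : (ratConj F).comp (ratConj F) = RingHom.id _ :=
      ratFunc_hom_ext (fun a => by simp [ratConj_C]) (by simp [ratConj_X])
    exact RingHom.congr_fun this x
  star_mul x y := by
    change ratConj F (x * y) = ratConj F y * ratConj F x
    rw [map_mul, mul_comm]
  star_add x y := map_add (ratConj F) x y

theorem ratFunc_star_C (a : F) : star (RatFunc.C a) = RatFunc.C (star a) := ratConj_C a

theorem ratFunc_star_X : star (RatFunc.X : RatFunc F) = RatFunc.X⁻¹ := ratConj_X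

end RatFunc

/-- The algebraic closure of `ℚ` in `ℂ`. -/
abbrev Qbar : Type := algebraicClosure ℚ ℂ

/-- Complex conjugation on the algebraic numbers. -/
instance : StarRing Qbar where
  star a := ⟨star (a : ℂ), by
    have h : IsAlgebraic ℚ (a : ℂ) := mem_algebraicClosure_iff.1 a.2
    exact mem_algebraicClosure_iff.2
      (h.algHom (Complex.conjAe.toAlgHom.restrictScalars ℚ))⟩
  star_involutive a := Subtype.ext (star_star (a : ℂ))
  star_mul a b := Subtype.ext (star_mul (a : ℂ) (b : ℂ))
  star_add a b := Subtype.ext (star_add (a : ℂ) (b : ℂ))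

theorem qbar_coe_star (a : Qbar) : ((star a : Qbar) : ℂ) = star (a : ℂ) := rfl

section Evaluation

/-- The ring homomorphism `ℚ̄(t) → ℂ`, `f(t) ↦ f(z)`, for `z` transcendental. -/
def evalHom (z : ℂ) (hz : Transcendental ℚ z) : RatFunc Qbar →+* ℂ :=
  RatFunc.liftRingHom (Polynomial.aeval (R := Qbar) z).toRingHom
    (nonZeroDivisors_le_comap_nonZeroDivisors_of_injective _
      (transcendental_iff_injective.1 hz.algebraicClosure))

theorem evalHom_C (z : ℂ) (hz : Transcendental ℚ z) (a : Qbar) :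
    evalHom z hz (RatFunc.C a) = a := by
  rw [evalHom, RatFunc.liftRingHom_C]
  simp

theorem evalHom_X (z : ℂ) (hz : Transcendental ℚ z) : evalHom z hz RatFunc.X = z := by
  rw [evalHom, RatFunc.liftRingHom_X]
  simp

theorem evalHom_star (z : Circle) (hz : Transcendental ℚ (z : ℂ)) (f : RatFunc Qbar) :
    evalHom z hz (star f) = star (evalHom z hz f) := by
  have : (evalHom z hz).comp (starRingEnd (RatFunc Qbar))
      = (starRingEnd ℂ).comp (evalHom z hz) := by
    refine ratFunc_hom_ext (fun a => ?_) ?_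
    · simp only [RingHom.comp_apply, starRingEnd_apply, ratFunc_star_C, evalHom_C, qbar_coe_star]
    · simp only [RingHom.comp_apply, starRingEnd_apply, ratFunc_star_X, map_inv₀, evalHom_X]
      exact (Circle.coe_inv z).symm.trans (Circle.coe_inv_eq_conj z)
  exact RingHom.congr_fun this f

/-- The map `L₀(ℚ̄(t)) → L₀(ℂ)`, `[(V, θ)] ↦ [(ℂ ⊗ V, θ)]`, where `f ∈ ℚ̄(t)` acts on `ℂ` as
multiplication by `f(z)`, for a transcendental `z` on the unit circle. -/
def specialize (z : Circle) (hz : Transcendental ℚ (z : ℂ)) : L0 (RatFunc Qbar) →+ L0 ℂ :=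
  letI : Algebra (RatFunc Qbar) ℂ := (evalHom z hz).toAlgebra
  haveI : StarModule (RatFunc Qbar) ℂ := ⟨fun f w => by
    change star (evalHom z hz f * w) = evalHom z hz (star f) * star w
    rw [evalHom_star, star_mul']⟩
  L0.baseChange ℂ

/-- The value `τ(z)` in `L₀(ℂ) ⊗ ℚ` of `τ` in `L₀(ℚ̄(t)) ⊗ ℚ`. -/
def value (z : Circle) (hz : Transcendental ℚ (z : ℂ)) (τ : L0Q (RatFunc Qbar)) : L0Q ℂ :=
  (specialize z hz).toIntLinearMap.rTensor ℚ τ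

theorem value_tmul (z : Circle) (hz : Transcendental ℚ (z : ℂ)) (x : L0 (RatFunc Qbar)) (q : ℚ) :
    value z hz (x ⊗ₜ q) = specialize z hz x ⊗ₜ q := rfl

end Evaluation

end HermWitt

end

/-!
Let `K = ℚ̄(t)`. The Cayley parameter `s = i (t + 1) / (t - 1)` is fixed by the involution of `K` and
maps the unit circle to the real line, so that `K` is `ℚ̄(s)` with conjugation of the coefficients.

The Witt group `L₀(K)` is generated by `⟨1⟩` and the classes `⟨s - r⟩`, with `r` a real algebraic
number (`generatedSubgroup_eq_top`). Indeed, hermitian forms are diagonal (`diagonal_induction`).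
A self-adjoint element of `K` is, up to sign and norms, the value at `s` of a real polynomial; this
is a product of factors `s - r` and of norms `(s - ρ)(s - ρ̄)`, up to sign
(`exists_eq_norm_mul_prod`). Products of several factors are removed one factor at a time by
`⟨a⟩ + ⟨b⟩ = ⟨a + b⟩ + ⟨a b (a + b)⟩`, applied to `a = (s - r) g` and `b = -(s - r') g`, whose sum
is a constant multiple of `g` (`L0.diag_mul_mul_eq`).

Hence an element `τ` of `L₀(K) ⊗ ℚ` is a rational combination of these generators. The signature is
a homomorphism `L₀(ℂ) → ℤ` (`L0.signatureHom`), and at the point of the circle where `s` has the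
value `x` the generator `⟨s - r⟩` has signature `sign (x - r)` (`signatureAt_tmul`). If `τ(z) = 0`
for every transcendental `z`, then a combination of a constant and of sign functions with distinct
jumps vanishes on the dense set of transcendental real numbers, so that all of its coefficients are
zero (`eq_zero_of_sum_sign_eq_zero`).
-/

noncomputable section

namespace HermWitt

open HermForm

/-! ### Diagonalization of hermitian forms -/

namespace HermForm

variable {K : Type u} [Field K] [StarRing K]

theorem isometric_of_surjective {A B : HermForm K} (e : A.V →ₗ[K] B.V)
    (he : ∀ a b, B.θ (e a) (e b) = A.θ a b) (hs : Function.Surjective e) : Isometric A B := by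
  -- a form-preserving map is injective because `θ` is non-singular
  have hi : Function.Injective e := by
    intro x y h
    refine A.nonsing.1 (LinearMap.ext fun z => ?_)
    rw [← he, ← he, h]
  exact ⟨LinearEquiv.ofBijective e ⟨hi, hs⟩, he⟩

/-- The form `⟨a⟩`, that is `(x, y) ↦ x̄ a y` on `K`, for a nonzero self-adjoint `a`. -/
abbrev rankOne (a : K) (h0 : a ≠ 0) (hs : star a = a) : HermForm K where
  V := K
  θ := LinearMap.mk₂'ₛₗ (starRingEnd K) (RingHom.id K) (fun x y => star x * a * y)
    (fun x x' y => by simp only [star_add]; ring)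
    (fun c x y => by simp only [smul_eq_mul, star_mul', starRingEnd_apply]; ring)
    (fun x y y' => by ring)
    (fun c x y => by simp only [smul_eq_mul, RingHom.id_apply]; ring)
  herm x y := by
    simp only [LinearMap.mk₂'ₛₗ_apply, star_mul', star_star, hs]
    ring
  nonsing := by
    constructor
    · intro x y h
      have h1 := LinearMap.congr_fun h (1 : K)
      simp only [LinearMap.mk₂'ₛₗ_apply, mul_one] at h1
      exact star_injective (mul_right_cancel₀ h0 h1)
    · intro f
      refine ⟨star (f 1 / a), LinearMap.ext_ring ?_⟩
      simp [h0]

@[simp] theorem rankOne_apply (a : K) (h0 : a ≠ 0) (hs : star a = a) (x y : K) :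
    (rankOne a h0 hs).θ x y = star x * a * y := rfl

/-- The orthogonal complement of an anisotropic vector. -/
abbrev orthogonal (A : HermForm K) (v : A.V) (hv : A.θ v v ≠ 0) : HermForm K where
  V := LinearMap.ker (A.θ v)
  θ := LinearMap.mk₂'ₛₗ (starRingEnd K) (RingHom.id K) (fun x y => A.θ x.1 y.1)
    (fun x x' y => by simp)
    (fun c x y => by simp)
    (fun x y y' => by simp)
    (fun c x y => by simp)
  herm x y := A.herm x.1 y.1
  nonsing := by
    constructor
    · intro x y h
      refine Subtype.ext (A.nonsing.1 (LinearMap.ext fun z => ?_))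
      -- it suffices to test against `v` and against the projection of `z` to the complement
      have hp : A.θ v (z - (A.θ v z / A.θ v v) • v) = 0 := by
        simp [hv]
      have h1 := LinearMap.congr_fun h ⟨_, LinearMap.mem_ker.2 hp⟩
      have hx : A.θ x.1 v = 0 := by rw [A.herm, LinearMap.mem_ker.1 x.2, star_zero]
      have hy : A.θ y.1 v = 0 := by rw [A.herm, LinearMap.mem_ker.1 y.2, star_zero]
      simpa [hx, hy] using h1
    · intro f
      -- `f` is extended to `A.V` through the orthogonal projection `g`, which kills `v`
      let g : A.V →ₗ[K] LinearMap.ker (A.θ v) :=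
        LinearMap.codRestrict _ (LinearMap.id - ((A.θ v v)⁻¹ • A.θ v).smulRight v) (fun z => by
          simp only [LinearMap.mem_ker, LinearMap.sub_apply, LinearMap.id_apply,
            LinearMap.smulRight_apply, LinearMap.smul_apply, map_sub, map_smul, smul_eq_mul]
          field_simp
          ring)
      have hgv : g v = 0 := Subtype.ext (by simp [g, hv])
      have hg : ∀ w : LinearMap.ker (A.θ v), g w.1 = w := fun w =>
        Subtype.ext (by simp [g])
      obtain ⟨x, hx⟩ := A.nonsing.2 (f.comp g)
      have hxv : A.θ v x = 0 := by rw [A.herm, hx]; simp [hgv]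
      refine ⟨⟨x, hxv⟩, LinearMap.ext fun w => ?_⟩
      simp [hx, hg]

theorem rankOne_sum_orthogonal (A : HermForm K) (v : A.V) (hv : A.θ v v ≠ 0) :
    Isometric ((rankOne (A.θ v v) hv (A.herm v v).symm).sum (A.orthogonal v hv)) A := by
  refine isometric_of_surjective
    (((LinearMap.id : K →ₗ[K] K).smulRight v).coprod (LinearMap.ker (A.θ v)).subtype :
      (K × LinearMap.ker (A.θ v)) →ₗ[K] A.V) ?_ ?_
  · rintro ⟨x, w⟩ ⟨y, w'⟩
    have h1 : A.θ v w'.1 = 0 := w'.2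
    have h2 : A.θ w.1 v = 0 := by rw [A.herm, LinearMap.mem_ker.1 w.2, star_zero]
    change A.θ (x • v + w.1) (y • v + w'.1) = star x * A.θ v v * y + A.θ w.1 w'.1
    simp only [map_add, LinearMap.add_apply, LinearMap.map_smulₛₗ, LinearMap.smul_apply, h1, h2,
      smul_eq_mul, starRingEnd_apply, RingHom.id_apply]
    ring
  · intro z
    have hp : A.θ v (z - (A.θ v z / A.θ v v) • v) = 0 := by simp [hv]
    refine ⟨(A.θ v z / A.θ v v, ⟨_, hp⟩), ?_⟩
    simp

theorem exists_apply_self_ne_zero (h2 : (2 : K) ≠ 0) (A : HermForm K) [Nontrivial A.V] :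
    ∃ v, A.θ v v ≠ 0 := by
  by_contra! h
  obtain ⟨v, hv⟩ := exists_ne (0 : A.V)
  have : A.θ v ≠ 0 := fun h' => hv (A.nonsing.1 (h'.trans (map_zero A.θ).symm))
  obtain ⟨w, hw⟩ : ∃ w, A.θ v w ≠ 0 := by
    by_contra! h'
    exact this (LinearMap.ext h')
  -- polarization, with `w` rescaled so that `θ(v, w) = 1`
  have key := h (v + (A.θ v w)⁻¹ • w)
  have h1 : A.θ v ((A.θ v w)⁻¹ • w) = 1 := by simp [hw]
  have h1' : A.θ ((A.θ v w)⁻¹ • w) v = 1 := by rw [A.herm, h1, star_one]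
  rw [map_add, map_add, LinearMap.add_apply, LinearMap.add_apply, h, h, h1, h1'] at key
  exact h2 (by linear_combination key)

theorem Isometric.finrank_eq {A B : HermForm K} (h : Isometric A B) :
    Module.finrank K A.V = Module.finrank K B.V :=
  h.choose.finrank_eq

/-- Diagonalization, as an induction principle: away from characteristic two, every hermitian form
is an orthogonal sum of forms of rank one. -/
theorem diagonal_induction (h2 : (2 : K) ≠ 0) {P : HermForm K → Prop}
    (isom : ∀ A B, Isometric A B → P A → P B) (zero : P (zeroForm K))
    (step : ∀ a h0 hs B, P B → P ((rankOne a h0 hs).sum B)) (A : HermForm K) : P A := by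
  induction hn : Module.finrank K A.V generalizing A with
  | zero =>
    have : Subsingleton A.V := Module.finrank_zero_iff.1 hn
    refine isom _ _ (isometric_of_surjective (0 : PUnit.{u + 1} →ₗ[K] A.V) (fun a b => ?_)
      fun x => ⟨0, Subsingleton.elim _ _⟩) zero
    simp
  | succ n ih =>
    have : Nontrivial A.V := Module.nontrivial_of_finrank_pos (R := K) (by omega)
    obtain ⟨v, hv⟩ := A.exists_apply_self_ne_zero h2
    have hA := A.rankOne_sum_orthogonal v hv
    refine isom _ _ hA (step _ _ _ _ (ih _ ?_))
    have h := hA.finrank_eq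
    change Module.finrank K (K × LinearMap.ker (A.θ v)) = _ at h
    rw [Module.finrank_prod, Module.finrank_self] at h
    change Module.finrank K (LinearMap.ker (A.θ v)) = n
    omega

theorem rankOne_congr {a b : K} (h0 : a ≠ 0) (hs : star a = a) (h0' : b ≠ 0) (hs' : star b = b)
    (g : K) (hg : b = star g * g * a) : Isometric (rankOne b h0' hs') (rankOne a h0 hs) := by
  have hg0 : g ≠ 0 := by
    rintro rfl
    simp [h0'] at hg
  refine isometric_of_surjective (LinearMap.mulLeft K g : K →ₗ[K] K)
    (fun (x y : K) => ?_) fun y => ?_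
  · change star (g * x) * a * (g * y) = star x * b * y
    rw [hg, star_mul']
    ring
  · exact ⟨g⁻¹ * y, by simp [hg0]⟩

theorem rankOne_sum_rankOne {a b : K} (ha : a ≠ 0) (hsa : star a = a) (hb : b ≠ 0)
    (hsb : star b = b) (hab : a + b ≠ 0) (hsab : star (a + b) = a + b)
    (hm : a * b * (a + b) ≠ 0) (hsm : star (a * b * (a + b)) = a * b * (a + b)) :
    Isometric ((rankOne (a + b) hab hsab).sum (rankOne (a * b * (a + b)) hm hsm))
      ((rankOne a ha hsa).sum (rankOne b hb hsb)) := by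
  -- the orthogonal vectors `(1, 1)` and `(b, -a)`
  refine isometric_of_surjective
    (((LinearMap.id : K →ₗ[K] K).smulRight ((1, 1) : K × K)).coprod
      ((LinearMap.id : K →ₗ[K] K).smulRight ((b, -a) : K × K))) ?_ ?_
  · rintro ⟨x, x'⟩ ⟨y, y'⟩
    simp [hsa, hsb]
    ring
  · rintro ⟨x, y⟩
    refine ⟨((a * x + b * y) / (a + b), (x - y) / (a + b)), ?_⟩
    ext
    · simp
      field_simp
      ring
    · simp
      field_simp
      ring

theorem rankOne_baseChange (L : Type u) [Field L] [StarRing L] [Algebra K L] [StarModule K L]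
    (a : K) (h0 : a ≠ 0) (hs : star a = a) (h0' : algebraMap K L a ≠ 0)
    (hs' : star (algebraMap K L a) = algebraMap K L a) :
    Isometric ((rankOne a h0 hs).baseChange L) (rankOne (algebraMap K L a) h0' hs') := by
  refine ⟨TensorProduct.AlgebraTensorModule.rid K L L, fun (x y : L ⊗[K] K) => ?_⟩
  change star (TensorProduct.AlgebraTensorModule.rid K L L x) * algebraMap K L a *
    TensorProduct.AlgebraTensorModule.rid K L L y = baseChangePairing L (rankOne a h0 hs).θ x y
  induction x with
  | zero => simp
  | add x x' hx hx' =>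
    rw [map_add, map_add, LinearMap.add_apply, star_add, ← hx, ← hx']
    ring
  | tmul c v =>
    induction y with
    | zero => simp
    | add y y' hy hy' =>
      rw [map_add, map_add, ← hy, ← hy']
      ring
    | tmul d w =>
      rw [baseChangePairing_tmul, rankOne_apply]
      simp only [TensorProduct.AlgebraTensorModule.rid_tmul, Algebra.smul_def, map_mul,
        star_algebraMap', star_mul']
      ring

end HermForm

namespace L0

variable {K : Type u} [Field K] [StarRing K]

open Classical in
/-- The Witt class of `⟨a⟩`; it is zero by convention if `a = 0` or `a` is not self-adjoint. -/
def diag (a : K) : L0 K :=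
  if h : a ≠ 0 ∧ star a = a then mk (rankOne a h.1 h.2) else 0

theorem diag_eq {a : K} (h0 : a ≠ 0) (hs : star a = a) : diag a = mk (rankOne a h0 hs) :=
  dif_pos ⟨h0, hs⟩

theorem diag_star_mul_mul {a : K} (h0 : a ≠ 0) (hs : star a = a) {g : K} (hg : g ≠ 0) :
    diag (star g * g * a) = diag a := by
  have h0' : star g * g * a ≠ 0 := by simp [h0, hg]
  have hs' : star (star g * g * a) = star g * g * a := by
    simp only [star_mul', star_star, hs]
    ring
  rw [diag_eq h0 hs, diag_eq h0' hs']
  exact mk_congr (rankOne_congr _ _ _ _ g rfl)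

theorem diag_neg {a : K} (h0 : a ≠ 0) (hs : star a = a) : diag (-a) = -diag a := by
  rw [diag_eq h0 hs, diag_eq (neg_ne_zero.2 h0) (by rw [star_neg, hs])]
  change _ = mk (rankOne a h0 hs).neg
  refine mk_congr ⟨LinearEquiv.refl K K, fun x y => ?_⟩
  change -(star x * a * y) = star x * -a * y
  ring

theorem diag_add_diag {a b : K} (ha : a ≠ 0) (hsa : star a = a) (hb : b ≠ 0) (hsb : star b = b)
    (hab : a + b ≠ 0) : diag a + diag b = diag (a + b) + diag (a * b * (a + b)) := by
  have hsab : star (a + b) = a + b := by rw [star_add, hsa, hsb]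
  have hm : a * b * (a + b) ≠ 0 := mul_ne_zero (mul_ne_zero ha hb) hab
  have hsm : star (a * b * (a + b)) = a * b * (a + b) := by rw [star_mul', star_mul', hsa, hsb, hsab]
  rw [diag_eq ha hsa, diag_eq hb hsb, diag_eq hab hsab, diag_eq hm hsm, mk_add, mk_add]
  exact (mk_congr (rankOne_sum_rankOne _ _ _ _ _ _ _ _)).symm

/-- If `y - y'` is a norm, then `⟨y g⟩ + ⟨-y' g⟩` represents `g` up to a norm, which expresses
`⟨y y' g⟩` through forms with fewer factors. -/
theorem diag_mul_mul_eq {y y' g d : K} (hy : y ≠ 0) (hsy : star y = y) (hy' : y' ≠ 0)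
    (hsy' : star y' = y') (hg : g ≠ 0) (hsg : star g = g) (hd : d ≠ 0)
    (h : y - y' = star d * d) :
    diag (y * (y' * g)) = diag g - diag (y * g) + diag (y' * g) := by
  have ha : y * g ≠ 0 := mul_ne_zero hy hg
  have hb : y' * g ≠ 0 := mul_ne_zero hy' hg
  have hsa : star (y * g) = y * g := by rw [star_mul', hsy, hsg]
  have hsb : star (y' * g) = y' * g := by rw [star_mul', hsy', hsg]
  have hp : y * (y' * g) ≠ 0 := mul_ne_zero hy hb
  have hsp : star (y * (y' * g)) = y * (y' * g) := by rw [star_mul', hsy, hsb]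
  have hsum : y * g + -(y' * g) = star d * d * g := by
    rw [← h]
    ring
  have hsum0 : star d * d * g ≠ 0 := mul_ne_zero (mul_ne_zero (star_ne_zero.2 hd) hd) hg
  have hprod : y * g * -(y' * g) * (star d * d * g) = star (d * g) * (d * g) * -(y * (y' * g)) := by
    rw [star_mul', hsg]
    ring
  have key := diag_add_diag ha hsa (neg_ne_zero.2 hb) (by rw [star_neg, hsb]) (by rwa [hsum])
  rw [hsum, hprod, diag_star_mul_mul (neg_ne_zero.2 hp) (by rw [star_neg, hsp]) (mul_ne_zero hd hg),
    diag_star_mul_mul hg hsg hd, diag_neg hb hsb, diag_neg hp hsp, ← sub_eq_add_neg,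
    ← sub_eq_add_neg, sub_eq_sub_iff_add_eq_add] at key
  rw [sub_add_eq_add_sub, eq_sub_iff_add_eq, add_comm, key]

/-- By diagonalization, the Witt group is generated by the classes of forms of rank one. -/
theorem mem_of_diag_mem (h2 : (2 : K) ≠ 0) (H : AddSubmonoid (L0 K))
    (h : ∀ a : K, a ≠ 0 → star a = a → diag a ∈ H) (x : L0 K) : x ∈ H := by
  obtain ⟨A, rfl⟩ := mk_surjective x
  refine diagonal_induction h2 (P := fun A => mk A ∈ H) (fun A B hAB hA => ?_) ?_
    (fun a h0 hs B hB => ?_) A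
  · rwa [← mk_congr hAB]
  · rw [mk_zeroForm]
    exact H.zero_mem
  · rw [← mk_add, ← diag_eq h0 hs]
    exact H.add_mem (h a h0 hs) hB

theorem baseChange_diag (L : Type u) [Field L] [StarRing L] [Algebra K L] [StarModule K L]
    {a : K} (h0 : a ≠ 0) (hs : star a = a) :
    L0.baseChange L (diag a) = diag (algebraMap K L a) := by
  have h0' : algebraMap K L a ≠ 0 := by simpa using h0
  have hs' : star (algebraMap K L a) = algebraMap K L a := by rw [← star_algebraMap', hs]
  rw [diag_eq h0 hs, diag_eq h0' hs']
  exact mk_congr (rankOne_baseChange L a h0 hs h0' hs')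

end L0

/-! ### The signature over the complex numbers -/

namespace HermForm

/-- A subspace on which the form is positive definite. -/
def PosDefOn (A : HermForm ℂ) (P : Submodule ℂ A.V) : Prop :=
  ∀ v ∈ P, v ≠ 0 → 0 < (A.θ v v).re

/-- The largest dimension of a positive definite subspace. -/
def posIndex (A : HermForm ℂ) : ℕ :=
  sSup {n | ∃ P : Submodule ℂ A.V, A.PosDefOn P ∧ Module.finrank ℂ P = n}

theorem bddAbove_posDefOn (A : HermForm ℂ) :
    BddAbove {n | ∃ P : Submodule ℂ A.V, A.PosDefOn P ∧ Module.finrank ℂ P = n} :=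
  ⟨Module.finrank ℂ A.V, by
    rintro _ ⟨P, -, rfl⟩
    exact P.finrank_le⟩

theorem PosDefOn.finrank_le_posIndex {A : HermForm ℂ} {P : Submodule ℂ A.V} (h : A.PosDefOn P) :
    Module.finrank ℂ P ≤ A.posIndex :=
  le_csSup A.bddAbove_posDefOn ⟨P, h, rfl⟩

theorem exists_finrank_eq_posIndex (A : HermForm ℂ) :
    ∃ P : Submodule ℂ A.V, A.PosDefOn P ∧ Module.finrank ℂ P = A.posIndex := by
  refine Nat.sSup_mem (s := {n | ∃ P : Submodule ℂ A.V, A.PosDefOn P ∧ Module.finrank ℂ P = n})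
    ⟨0, ⊥, ?_, by simp⟩ A.bddAbove_posDefOn
  intro v hv h
  exact absurd ((Submodule.mem_bot ℂ).1 hv) h

theorem posIndex_add_finrank_le (A : HermForm ℂ) (Q : Submodule ℂ A.V)
    (hQ : ∀ v ∈ Q, (A.θ v v).re ≤ 0) :
    A.posIndex + Module.finrank ℂ Q ≤ Module.finrank ℂ A.V := by
  obtain ⟨P, hP, h⟩ := A.exists_finrank_eq_posIndex
  rw [← h]
  refine Submodule.finrank_add_finrank_le_of_disjoint (Submodule.disjoint_def.2 fun v hv hv' => ?_)
  by_contra h0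
  exact (hP v hv h0).not_ge (hQ v hv')

theorem Isometric.posIndex_le {A B : HermForm ℂ} (h : Isometric A B) :
    A.posIndex ≤ B.posIndex := by
  obtain ⟨e, he⟩ := h
  obtain ⟨P, hP, h⟩ := A.exists_finrank_eq_posIndex
  rw [← h, ← LinearEquiv.finrank_map_eq e P]
  refine PosDefOn.finrank_le_posIndex ?_
  rintro _ ⟨v, hv, rfl⟩ h0
  change 0 < (B.θ (e v) (e v)).re
  rw [he]
  exact hP v hv fun h => h0 (by simp [h])

theorem Isometric.posIndex_eq {A B : HermForm ℂ} (h : Isometric A B) :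
    A.posIndex = B.posIndex :=
  h.posIndex_le.antisymm h.symm.posIndex_le

theorem posIndex_add_le_sum (A B : HermForm ℂ) :
    A.posIndex + B.posIndex ≤ (A.sum B).posIndex := by
  obtain ⟨P, hP, h⟩ := A.exists_finrank_eq_posIndex
  obtain ⟨Q, hQ, h'⟩ := B.exists_finrank_eq_posIndex
  let f : (P × Q) →ₗ[ℂ] A.V × B.V := P.subtype.prodMap Q.subtype
  have hf : Function.Injective f := P.subtype_injective.prodMap Q.subtype_injective
  have hPQ : (A.sum B).PosDefOn (LinearMap.range f) := by
    rintro _ ⟨⟨⟨v, hv⟩, ⟨w, hw⟩⟩, rfl⟩ (h0 : (v, w) ≠ 0)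
    change 0 < (A.θ v v + B.θ w w).re
    rw [Complex.add_re]
    by_cases hv0 : v = 0
    · subst hv0
      have hw0 : w ≠ 0 := by
        rintro rfl
        exact h0 rfl
      simpa using hQ w hw hw0
    · by_cases hw0 : w = 0
      · subst hw0
        simpa using hP v hv hv0
      · exact add_pos (hP v hv hv0) (hQ w hw hw0)
  rw [← h, ← h', ← Module.finrank_prod, ← LinearMap.finrank_range_of_inj hf]
  exact hPQ.finrank_le_posIndex

theorem sum_neg (A B : HermForm ℂ) : Isometric (A.neg.sum B.neg) (A.sum B).neg := by
  refine ⟨LinearEquiv.refl ℂ (A.V × B.V), fun x y => ?_⟩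
  change -(A.θ x.1 y.1 + B.θ x.2 y.2) = -A.θ x.1 y.1 + -B.θ x.2 y.2
  ring

theorem posIndex_rankOne {a : ℂ} (h0 : a ≠ 0) (hs : star a = a) (ha : 0 < a.re) :
    (rankOne a h0 hs).posIndex = 1 := by
  refine le_antisymm ?_ ?_
  · obtain ⟨P, -, h⟩ := (rankOne a h0 hs).exists_finrank_eq_posIndex
    rw [← h]
    exact P.finrank_le.trans (Module.finrank_self ℂ).le
  · have hP : (rankOne a h0 hs).PosDefOn ⊤ := by
      intro (v : ℂ) _ hv
      have : (rankOne a h0 hs).θ v v = (Complex.normSq v : ℂ) * a := by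
        rw [rankOne_apply, Complex.normSq_eq_conj_mul_self, starRingEnd_apply]
        ring
      rw [this, Complex.re_ofReal_mul]
      exact mul_pos (Complex.normSq_pos.2 hv) ha
    refine le_trans ?_ hP.finrank_le_posIndex
    rw [finrank_top]
    exact (Module.finrank_self ℂ).ge

theorem neg_rankOne_isometric {a : ℂ} (h0 : a ≠ 0) (hs : star a = a) (h0' : -a ≠ 0)
    (hs' : star (-a) = -a) : Isometric (rankOne (-a) h0' hs') (rankOne a h0 hs).neg := by
  refine ⟨LinearEquiv.refl ℂ ℂ, fun x y => ?_⟩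
  change -(star x * a * y) = star x * -a * y
  ring

theorem re_ne_zero_of_star_eq {a : ℂ} (h0 : a ≠ 0) (hs : star a = a) : a.re ≠ 0 := fun h =>
  h0 (Complex.ext h (Complex.conj_eq_iff_im.1 hs))

/-- Positive definite and negative definite subspaces of maximal dimension fill the space. -/
theorem posIndex_add_posIndex_neg (A : HermForm ℂ) :
    A.posIndex + A.neg.posIndex = Module.finrank ℂ A.V := by
  refine le_antisymm ?_ ?_
  · obtain ⟨Q, hQ, h⟩ := A.neg.exists_finrank_eq_posIndex
    rw [← h]
    refine A.posIndex_add_finrank_le Q fun v hv => ?_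
    by_cases h0 : v = 0
    · simp [h0]
    · have : 0 < (-(A.θ v v)).re := hQ v hv h0
      rw [Complex.neg_re] at this
      linarith
  · refine diagonal_induction (P := fun A : HermForm ℂ => Module.finrank ℂ A.V ≤
      A.posIndex + A.neg.posIndex) two_ne_zero (fun A B h hA => ?_) ?_ (fun a h0 hs B hB => ?_) A
    · rwa [← h.finrank_eq, ← h.posIndex_eq, ← (neg_congr h).posIndex_eq]
    · rw [Module.finrank_zero_of_subsingleton]
      exact Nat.zero_le _
    · have h1 : 1 ≤ (rankOne a h0 hs).posIndex + (rankOne a h0 hs).neg.posIndex := by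
        rcases (re_ne_zero_of_star_eq h0 hs).lt_or_gt with h | h
        · have h0' := neg_ne_zero.2 h0
          have hs' : star (-a) = -a := by rw [star_neg, hs]
          rw [← (neg_rankOne_isometric h0 hs h0' hs').posIndex_eq,
            posIndex_rankOne h0' hs' (by simpa using h)]
          omega
        · rw [posIndex_rankOne h0 hs h]
          omega
      have h2 := posIndex_add_le_sum (rankOne a h0 hs) B
      have h3 := posIndex_add_le_sum (rankOne a h0 hs).neg B.neg
      rw [(sum_neg _ _).posIndex_eq] at h3
      change Module.finrank ℂ (ℂ × B.V) ≤ _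
      rw [Module.finrank_prod, Module.finrank_self]
      omega

/-- The signature of a hermitian form over `ℂ`. -/
def signature (A : HermForm ℂ) : ℤ := A.posIndex - A.neg.posIndex

theorem Isometric.signature_eq {A B : HermForm ℂ} (h : Isometric A B) :
    A.signature = B.signature := by
  rw [signature, signature, h.posIndex_eq, (neg_congr h).posIndex_eq]

theorem signature_sum (A B : HermForm ℂ) :
    (A.sum B).signature = A.signature + B.signature := by
  -- both indices are superadditive, and their total is additive
  have h2 := posIndex_add_le_sum A B
  have h3 := posIndex_add_le_sum A.neg B.neg
  rw [(sum_neg _ _).posIndex_eq] at h3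
  have hA := A.posIndex_add_posIndex_neg
  have hB := B.posIndex_add_posIndex_neg
  have hAB : _ = Module.finrank ℂ (A.V × B.V) := (A.sum B).posIndex_add_posIndex_neg
  rw [Module.finrank_prod] at hAB
  simp only [signature]
  omega

theorem IsMetabolic.signature_eq_zero {A : HermForm ℂ} (h : A.IsMetabolic) :
    A.signature = 0 := by
  -- an isotropic subspace bounds both indices by half the dimension
  obtain ⟨P, hd, hP⟩ := h
  have h1 := A.posIndex_add_finrank_le P fun v hv => by simp [hP v hv v hv]
  have h2 : A.neg.posIndex + Module.finrank ℂ P ≤ Module.finrank ℂ A.V :=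
    A.neg.posIndex_add_finrank_le P fun v hv => by
      change (-(A.θ v v)).re ≤ 0
      simp [hP v hv v hv]
  have hA := A.posIndex_add_posIndex_neg
  simp only [signature]
  omega

theorem signature_rankOne_of_pos {a : ℂ} (h0 : a ≠ 0) (hs : star a = a) (ha : 0 < a.re) :
    (rankOne a h0 hs).signature = 1 := by
  have h := (rankOne a h0 hs).posIndex_add_posIndex_neg
  have h' : Module.finrank ℂ (rankOne a h0 hs).V = 1 := Module.finrank_self ℂ
  rw [posIndex_rankOne h0 hs ha] at h
  rw [signature, posIndex_rankOne h0 hs ha]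
  omega

end HermForm

namespace L0

/-- The signature, as a homomorphism on the Witt group of `ℂ`. -/
def signatureHom : L0 ℂ →+ ℤ :=
  lift signature (fun _ _ h => h.signature_eq) signature_sum
    (by
      have h := (sum_zero' (zeroForm ℂ)).signature_eq
      rwa [signature_sum, add_eq_left] at h)
    (fun _ h => h.signature_eq_zero)

theorem signatureHom_diag {a : ℂ} (h0 : a ≠ 0) (hs : star a = a) :
    signatureHom (diag a) = SignType.sign a.re := by
  have key : ∀ b : ℂ, 0 < b.re → star b = b → signatureHom (diag b) = 1 := fun b hb hsb => by
    have hb0 : b ≠ 0 := by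
      rintro rfl
      simp at hb
    rw [diag_eq hb0 hsb]
    exact signature_rankOne_of_pos hb0 hsb hb
  rcases (re_ne_zero_of_star_eq h0 hs).lt_or_gt with h | h
  · have := key (-a) (by simpa using h) (by rw [star_neg, hs])
    rw [diag_neg h0 hs, map_neg] at this
    rw [sign_neg h]
    simp
    omega
  · rw [key a h hs, sign_pos h]
    simp

end L0

/-! ### Self-adjoint rational functions -/

section

open Polynomial

instance : IsAlgClosed Qbar :=
  have := algebraicClosure.isAlgClosure ℚ ℂ
  this.isAlgClosed

/-- The imaginary unit as an algebraic number. -/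
def qbarI : Qbar :=
  ⟨Complex.I, mem_algebraicClosure_iff.2 Complex.isIntegral_rat_I.isAlgebraic⟩

theorem qbarI_mul_self : qbarI * qbarI = -1 := Subtype.ext Complex.I_mul_I

theorem star_qbarI : star qbarI = -qbarI := Subtype.ext Complex.conj_I

/-- The parameter `s = i (t + 1) / (t - 1)` of `ℚ̄(t)`. It is fixed by the involution, and maps the
unit circle to the real line. -/
def cayley : RatFunc Qbar :=
  RatFunc.C qbarI * (RatFunc.X + 1) / (RatFunc.X - 1)

theorem ratFunc_X_ne_C (a : Qbar) : (RatFunc.X : RatFunc Qbar) ≠ RatFunc.C a := fun h =>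
  RatFunc.transcendental_X (K := Qbar) (h ▸ isAlgebraic_algebraMap a)

theorem ratFunc_X_sub_one_ne_zero : (RatFunc.X - 1 : RatFunc Qbar) ≠ 0 := by
  rw [sub_ne_zero, ← map_one RatFunc.C]
  exact ratFunc_X_ne_C 1

theorem ratFunc_C_qbarI_mul_self : RatFunc.C qbarI * RatFunc.C qbarI = -1 := by
  rw [← map_mul, qbarI_mul_self, map_neg, map_one]

theorem star_cayley : star cayley = cayley := by
  have h1 := ratFunc_X_sub_one_ne_zero
  have h2 : (RatFunc.X : RatFunc Qbar) ≠ 0 := RatFunc.X_ne_zero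
  have h3 : (1 - RatFunc.X : RatFunc Qbar) ≠ 0 := by
    rw [← neg_sub]
    exact neg_ne_zero.2 h1
  have h4 : (RatFunc.X⁻¹ - 1 : RatFunc Qbar) ≠ 0 := by
    intro h
    apply h3
    rw [sub_eq_zero] at h ⊢
    exact (inv_eq_one.1 h).symm
  simp only [cayley, star_div₀, star_mul', star_add, star_sub, star_one, ratFunc_star_C,
    ratFunc_star_X, star_qbarI, map_neg]
  rw [div_eq_div_iff h4 h1]
  field_simp
  ring

theorem cayley_ne_C (a : Qbar) : cayley ≠ RatFunc.C a := by
  intro h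
  have h1 := ratFunc_X_sub_one_ne_zero
  rw [cayley, div_eq_iff h1] at h
  -- solving for `t` would make it a constant
  have hX : (RatFunc.C (qbarI - a)) * RatFunc.X = RatFunc.C (-(qbarI + a)) := by
    simp only [map_sub, map_neg, map_add]
    linear_combination h
  by_cases ha : qbarI - a = 0
  · rw [ha, map_zero, zero_mul] at hX
    have h2 : qbarI + a = 0 := by
      have := (map_eq_zero RatFunc.C).1 hX.symm
      exact neg_eq_zero.1 this
    have h3 : (2 : Qbar) * qbarI = 0 := by linear_combination ha + h2
    have h4 : qbarI ≠ 0 := by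
      intro h
      have := qbarI_mul_self
      rw [h, mul_zero] at this
      exact neg_ne_zero.2 one_ne_zero this.symm
    exact mul_ne_zero two_ne_zero h4 h3
  · apply ratFunc_X_ne_C (-(qbarI + a) / (qbarI - a))
    rw [map_div₀, eq_div_iff ((_root_.map_ne_zero _).2 ha), ← hX, mul_comm]

open scoped IntermediateField in
/-- `ℚ̄(t)` is generated by `s`, since `t = (s + i) / (s - i)`. -/
theorem exists_eq_aeval_cayley_div (f : RatFunc Qbar) :
    ∃ P Q : Qbar[X], f = aeval cayley P / aeval cayley Q := by
  rw [← IntermediateField.mem_adjoin_simple_iff]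
  have hs : cayley ∈ Qbar⟮cayley⟯ := IntermediateField.mem_adjoin_simple_self Qbar cayley
  have hi : RatFunc.C qbarI ∈ Qbar⟮cayley⟯ := by
    rw [← RatFunc.algebraMap_eq_C]
    exact algebraMap_mem _ _
  have hX : (RatFunc.X : RatFunc Qbar) ∈ Qbar⟮cayley⟯ := by
    have : (RatFunc.X : RatFunc Qbar)
        = (cayley + RatFunc.C qbarI) / (cayley - RatFunc.C qbarI) := by
      rw [eq_div_iff (sub_ne_zero.2 (cayley_ne_C _)), cayley]
      have h1 := ratFunc_X_sub_one_ne_zero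
      field_simp
      ring
    rw [this]
    exact div_mem (add_mem hs hi) (sub_mem hs hi)
  have htop : (⊤ : IntermediateField Qbar (RatFunc Qbar)) ≤ Qbar⟮cayley⟯ := by
    rw [← RatFunc.adjoin_X]
    exact IntermediateField.adjoin_simple_le_iff.2 hX
  exact htop IntermediateField.mem_top

theorem star_aeval_cayley (R : Qbar[X]) :
    star (aeval cayley R) = aeval cayley (R.map (starRingEnd Qbar)) := by
  induction R using Polynomial.induction_on' with
  | add p q hp hq => rw [map_add, star_add, hp, hq, Polynomial.map_add, map_add]
  | monomial n a =>
    simp [aeval_monomial, star_cayley, ratFunc_star_C, RatFunc.algebraMap_eq_C, starRingEnd_apply]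

theorem exists_eq_sign_mul_norm {c : Qbar} (h0 : c ≠ 0) (hs : star c = c) :
    ∃ d : Qbar, d ≠ 0 ∧ (c = star d * d ∨ c = -(star d * d)) := by
  obtain ⟨d, hd⟩ := IsAlgClosed.exists_pow_nat_eq c (n := 2) two_pos
  refine ⟨d, ?_, ?_⟩
  · rintro rfl
    simp at hd
    exact h0 hd.symm
  · -- `(d̄ d)² = c̄ c = c²`
    have h : c ^ 2 = (star d * d) ^ 2 := by
      rw [mul_pow, ← star_pow, hd, hs, sq]
    exact sq_eq_sq_iff_eq_or_eq_neg.1 h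

/-- The rational function `s - r`, for a real algebraic number `r`. -/
def cayleySub (r : selfAdjoint Qbar) : RatFunc Qbar := cayley - RatFunc.C (r : Qbar)

theorem cayleySub_ne_zero (r : selfAdjoint Qbar) : cayleySub r ≠ 0 :=
  sub_ne_zero.2 (cayley_ne_C _)

theorem star_cayleySub (r : selfAdjoint Qbar) : star (cayleySub r) = cayleySub r := by
  rw [cayleySub, star_sub, star_cayley, ratFunc_star_C, r.2.star_eq]

/-- A real polynomial in `s` is a product of linear factors and norms, up to sign. -/
theorem eq_mul_norm_of_conj_eq (R : Qbar[X]) (hR : R.map (starRingEnd Qbar) = R) (h0 : R ≠ 0) :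
    ∃ (S : Multiset (selfAdjoint Qbar)) (g : RatFunc Qbar), g ≠ 0 ∧
      (aeval cayley R = star g * g * (S.map cayleySub).prod ∨
        aeval cayley R = -(star g * g * (S.map cayleySub).prod)) := by
  induction hn : R.natDegree using Nat.strong_induction_on generalizing R with
  | _ n ih =>
  by_cases hdeg : R.degree = 0
  · obtain ⟨c, rfl⟩ : ∃ c, R = C c := ⟨_, eq_C_of_degree_eq_zero hdeg⟩
    have hc : c ≠ 0 := by
      rintro rfl
      simp at h0
    have hsc : star c = c := by
      rw [map_C] at hR
      exact C_injective hR
    obtain ⟨d, hd, h⟩ := exists_eq_sign_mul_norm hc hsc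
    refine ⟨0, RatFunc.C d, by simpa using hd, ?_⟩
    rw [aeval_C, RatFunc.algebraMap_eq_C, ratFunc_star_C, Multiset.map_zero, Multiset.prod_zero,
      mul_one, ← map_mul, ← map_neg]
    exact h.imp (congrArg _) (congrArg _)
  · obtain ⟨ρ, hρ⟩ := IsAlgClosed.exists_root R hdeg
    obtain ⟨R₁, rfl⟩ := dvd_iff_isRoot.2 hρ
    have hR₁ : R₁ ≠ 0 := right_ne_zero_of_mul h0
    by_cases hs : star ρ = ρ
    · have hc : R₁.map (starRingEnd Qbar) = R₁ := by
        rw [Polynomial.map_mul, Polynomial.map_sub, map_X, map_C, starRingEnd_apply, hs] at hR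
        exact mul_left_cancel₀ (X_sub_C_ne_zero ρ) hR
      have hlt : R₁.natDegree < n := by
        rw [← hn, natDegree_mul (X_sub_C_ne_zero ρ) hR₁, natDegree_X_sub_C]
        omega
      obtain ⟨S, g, hg, h⟩ := ih _ hlt R₁ hc hR₁ rfl
      let r : selfAdjoint Qbar := ⟨ρ, hs⟩
      refine ⟨r ::ₘ S, g, hg, ?_⟩
      have hr : cayleySub r = cayley - RatFunc.C ρ := rfl
      rw [map_mul, map_sub, aeval_X, aeval_C, RatFunc.algebraMap_eq_C, Multiset.map_cons,
        Multiset.prod_cons, hr]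
      refine h.imp (fun h => ?_) (fun h => ?_) <;> rw [h] <;> ring
    · -- the conjugate of a non-real root is a root too, and the two factors make up a norm
      have hroot : R₁.IsRoot (star ρ) := by
        have h1 : ((X - C ρ) * R₁).eval (star ρ) = 0 := by
          have := Polynomial.eval_map_apply (f := starRingEnd Qbar) (p := (X - C ρ) * R₁) ρ
          rw [hR, hρ.eq_zero, map_zero] at this
          exact this
        rw [eval_mul, eval_sub, eval_X, eval_C] at h1
        exact (mul_eq_zero.1 h1).resolve_left (sub_ne_zero.2 hs)
      obtain ⟨R₂, rfl⟩ := dvd_iff_isRoot.2 hroot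
      have hR₂ : R₂ ≠ 0 := right_ne_zero_of_mul hR₁
      have hc : R₂.map (starRingEnd Qbar) = R₂ := by
        simp only [Polynomial.map_mul, Polynomial.map_sub, map_X, map_C, starRingEnd_apply,
          star_star] at hR
        rw [← mul_assoc, ← mul_assoc, mul_comm (X - C (star ρ))] at hR
        exact mul_left_cancel₀ (mul_ne_zero (X_sub_C_ne_zero _) (X_sub_C_ne_zero _)) hR
      have hlt : R₂.natDegree < n := by
        rw [← hn, natDegree_mul (X_sub_C_ne_zero ρ) hR₁, natDegree_mul (X_sub_C_ne_zero _) hR₂,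
          natDegree_X_sub_C, natDegree_X_sub_C]
        omega
      obtain ⟨S, g, hg, h⟩ := ih _ hlt R₂ hc hR₂ rfl
      refine ⟨S, (cayley - RatFunc.C ρ) * g,
        mul_ne_zero (sub_ne_zero.2 (cayley_ne_C ρ)) hg, ?_⟩
      rw [map_mul, map_mul, map_sub, map_sub, aeval_X, aeval_C, aeval_C, RatFunc.algebraMap_eq_C,
        star_mul', star_sub, star_cayley, ratFunc_star_C]
      refine h.imp (fun h => ?_) (fun h => ?_) <;> rw [h] <;> ring

theorem exists_eq_norm_mul_prod {f : RatFunc Qbar} (h0 : f ≠ 0) (hs : star f = f) :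
    ∃ (S : Multiset (selfAdjoint Qbar)) (g : RatFunc Qbar), g ≠ 0 ∧
      (f = star g * g * (S.map cayleySub).prod ∨
        f = -(star g * g * (S.map cayleySub).prod)) := by
  obtain ⟨P, Q, rfl⟩ := exists_eq_aeval_cayley_div f
  have hQ : aeval cayley Q ≠ 0 := by
    intro h
    simp [h] at h0
  have hQs : star (aeval cayley Q) ≠ 0 := star_ne_zero.2 hQ
  -- `f` is, up to the norm of `Q(s)` and the factor `2`, itself a norm, the value at `s` of a real
  -- polynomial
  let R₀ := P * Q.map (starRingEnd Qbar)
  let R := R₀ + R₀.map (starRingEnd Qbar)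
  have hconj : ∀ p : Qbar[X], (p.map (starRingEnd Qbar)).map (starRingEnd Qbar) = p := fun p => by
    rw [Polynomial.map_map]
    convert Polynomial.map_id
    ext a
    simp
  have hR : R.map (starRingEnd Qbar) = R := by
    rw [Polynomial.map_add, hconj, add_comm]
  have hR₀ : aeval cayley R₀
      = aeval cayley P / aeval cayley Q * (aeval cayley Q * star (aeval cayley Q)) := by
    rw [map_mul, star_aeval_cayley]
    field_simp
  have hRv : aeval cayley R
      = 2 * (aeval cayley P / aeval cayley Q * (aeval cayley Q * star (aeval cayley Q))) := by
    rw [map_add, ← star_aeval_cayley, hR₀, star_mul', hs, star_mul', star_star]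
    ring
  have hR0 : R ≠ 0 := by
    intro h
    rw [h, map_zero] at hRv
    exact mul_ne_zero two_ne_zero (mul_ne_zero h0 (mul_ne_zero hQ hQs)) hRv.symm
  obtain ⟨S, g, hg, h⟩ := eq_mul_norm_of_conj_eq R hR hR0
  obtain ⟨d, hd, hd2⟩ : ∃ d : RatFunc Qbar, d ≠ 0 ∧ star d * d = 2 := by
    have h2 : star (1 + RatFunc.C qbarI) * (1 + RatFunc.C qbarI) = 2 := by
      rw [star_add, star_one, ratFunc_star_C, star_qbarI, map_neg]
      linear_combination -ratFunc_C_qbarI_mul_self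
    refine ⟨1 + RatFunc.C qbarI, fun h => ?_, h2⟩
    rw [h, mul_zero] at h2
    exact two_ne_zero h2.symm
  have hds : star d ≠ 0 := star_ne_zero.2 hd
  refine ⟨S, g / (d * aeval cayley Q), div_ne_zero hg (mul_ne_zero hd hQ), ?_⟩
  rw [hRv, ← hd2] at h
  rw [star_div₀, star_mul']
  refine h.imp (fun h => ?_) (fun h => ?_)
  · rw [div_mul_div_comm, div_mul_eq_mul_div, ← h]
    field_simp
  · rw [div_mul_div_comm, div_mul_eq_mul_div, ← neg_div, ← h]
    field_simp

/-! ### Generators of the Witt group -/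

/-- The subgroup generated by `⟨1⟩` and the classes `⟨s - r⟩`. -/
def generatedSubgroup : AddSubgroup (L0 (RatFunc Qbar)) :=
  AddSubgroup.closure (insert (L0.diag 1) (Set.range fun r => L0.diag (cayleySub r)))

theorem diag_one_mem : L0.diag 1 ∈ generatedSubgroup :=
  AddSubgroup.subset_closure (Set.mem_insert _ _)

theorem diag_cayleySub_mem (r : selfAdjoint Qbar) :
    L0.diag (cayleySub r) ∈ generatedSubgroup :=
  AddSubgroup.subset_closure (Set.mem_insert_of_mem _ ⟨r, rfl⟩)

theorem diag_cayleySub_mul_mem {r r' : selfAdjoint Qbar} {g : RatFunc Qbar}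
    (hg : g ≠ 0) (hs : star g = g) (h : L0.diag g ∈ generatedSubgroup)
    (h1 : L0.diag (cayleySub r * g) ∈ generatedSubgroup)
    (h2 : L0.diag (cayleySub r' * g) ∈ generatedSubgroup) :
    L0.diag (cayleySub r * (cayleySub r' * g)) ∈ generatedSubgroup := by
  have hr := cayleySub_ne_zero r
  have hr' := cayleySub_ne_zero r'
  have hsr := star_cayleySub r
  have hsr' := star_cayleySub r'
  by_cases hrr : r' = r
  · subst hrr
    have := L0.diag_star_mul_mul hg hs hr'
    rw [hsr', mul_assoc] at this
    rwa [this]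
  have hne : (r' - r : Qbar) ≠ 0 := sub_ne_zero.2 fun h => hrr (Subtype.ext h)
  obtain ⟨d, hd0, hd⟩ :=
    exists_eq_sign_mul_norm hne (by rw [star_sub, r.2.star_eq, r'.2.star_eq])
  have hD : RatFunc.C d ≠ 0 := (_root_.map_ne_zero _).2 hd0
  -- the real constant `r' - r` is a norm up to sign; the sign decides the roles of `r` and `r'`
  have hsub : cayleySub r - cayleySub r' = RatFunc.C (r' - r : Qbar) := by
    rw [cayleySub, cayleySub, map_sub]
    ring
  rcases hd with hd | hd
  · rw [L0.diag_mul_mul_eq hr hsr hr' hsr' hg hs hD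
      (by rw [hsub, hd, map_mul, ratFunc_star_C])]
    exact add_mem (sub_mem h h1) h2
  · rw [mul_left_comm, L0.diag_mul_mul_eq hr' hsr' hr hsr hg hs hD
      (by rw [← neg_sub, hsub, hd, map_neg, neg_neg, map_mul, ratFunc_star_C])]
    exact add_mem (sub_mem h h2) h1

theorem prod_cayleySub_ne_zero (S : Multiset (selfAdjoint Qbar)) : (S.map cayleySub).prod ≠ 0 := by
  rw [Ne, Multiset.prod_eq_zero_iff, Multiset.mem_map]
  rintro ⟨r, -, h⟩
  exact cayleySub_ne_zero r h

theorem star_prod_cayleySub (S : Multiset (selfAdjoint Qbar)) :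
    star (S.map cayleySub).prod = (S.map cayleySub).prod := by
  induction S using Multiset.induction_on with
  | empty => simp
  | cons r S ih => rw [Multiset.map_cons, Multiset.prod_cons, star_mul', ih, star_cayleySub]

theorem diag_prod_mem (S : Multiset (selfAdjoint Qbar)) :
    L0.diag (S.map cayleySub).prod ∈ generatedSubgroup := by
  induction hn : S.card using Nat.strong_induction_on generalizing S with
  | _ n ih =>
  induction S using Multiset.induction_on with
  | empty => simpa using diag_one_mem
  | cons r S _ =>
    induction S using Multiset.induction_on with
    | empty => simpa using diag_cayleySub_mem r
    | cons r' S _ =>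
      simp only [Multiset.card_cons] at hn
      rw [Multiset.map_cons, Multiset.prod_cons, Multiset.map_cons, Multiset.prod_cons]
      refine diag_cayleySub_mul_mem (prod_cayleySub_ne_zero S) (star_prod_cayleySub S)
        (ih _ (by omega) S rfl) ?_ ?_
      · rw [← Multiset.prod_cons, ← Multiset.map_cons]
        exact ih _ (by rw [Multiset.card_cons]; omega) (r ::ₘ S) rfl
      · rw [← Multiset.prod_cons, ← Multiset.map_cons]
        exact ih _ (by rw [Multiset.card_cons]; omega) (r' ::ₘ S) rfl

theorem generatedSubgroup_eq_top : generatedSubgroup = ⊤ := by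
  rw [eq_top_iff]
  intro x _
  refine L0.mem_of_diag_mem two_ne_zero generatedSubgroup.toAddSubmonoid (fun f h0 hs => ?_) x
  obtain ⟨S, g, hg, h⟩ := exists_eq_norm_mul_prod h0 hs
  have hS := L0.diag_star_mul_mul (prod_cayleySub_ne_zero S) (star_prod_cayleySub S) hg
  change L0.diag f ∈ generatedSubgroup
  rcases h with rfl | h
  · rw [hS]
    exact diag_prod_mem S
  · rw [eq_neg_iff_add_eq_zero, add_comm, ← eq_neg_iff_add_eq_zero] at h
    rw [← neg_mem_iff, ← L0.diag_neg h0 hs, ← h, hS]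
    exact diag_prod_mem S

end

/-! ### Signatures at the points of the circle -/

/-- A combination of a constant and sign functions with distinct jumps vanishes on a dense set only
if all of its coefficients vanish. -/
theorem eq_zero_of_sum_sign_eq_zero {ι : Type*} {ρ : ι → ℝ} (hρ : Function.Injective ρ)
    {D : Set ℝ} (hD : Dense D) (c : Option ι →₀ ℚ)
    (h : ∀ x ∈ D, ∑ o ∈ c.support,
      ((o.elim 1 fun i => SignType.sign (x - ρ i) : SignType) : ℚ) * c o = 0) : c = 0 := by
  have hsome : ∀ i, c (some i) = 0 := by
    intro i
    by_contra hi
    -- an interval around `ρ i` that contains no other jump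
    let F : Set ℝ := {y | ∃ j, some j ∈ c.support ∧ ρ j = y ∧ j ≠ i}
    have hF : F.Finite := by
      refine (c.support.finite_toSet.image fun o => o.elim 0 ρ).subset ?_
      rintro _ ⟨j, hj, rfl, -⟩
      exact ⟨some j, hj, rfl⟩
    have hiF : ρ i ∈ Fᶜ := by
      rintro ⟨j, -, hj, hne⟩
      exact hne (hρ hj)
    obtain ⟨ε, hε, hball⟩ := Metric.isOpen_iff.1 hF.isClosed.isOpen_compl _ hiF
    obtain ⟨x, hx, hxl, hxr⟩ := hD.exists_between (show ρ i - ε < ρ i by linarith)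
    obtain ⟨y, hy, hyl, hyr⟩ := hD.exists_between (show ρ i < ρ i + ε by linarith)
    have key := congrArg₂ (· - ·) (h y hy) (h x hx)
    simp only [← Finset.sum_sub_distrib, sub_zero] at key
    rw [Finset.sum_eq_single (some i)] at key
    · have h1 : SignType.sign (y - ρ i) = 1 := sign_pos (by linarith)
      have h2 : SignType.sign (x - ρ i) = -1 := sign_neg (by linarith)
      simp only [Option.elim_some, h1, h2] at key
      norm_num at key
      exact hi (by linarith)
    · rintro (_ | j) hj hne
      · simp
      · have hji : j ≠ i := fun h => hne (congrArg some h)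
        have hj' : ρ j ∈ F := ⟨j, hj, rfl, hji⟩
        have hjb : ε ≤ |ρ j - ρ i| := by
          by_contra! hlt
          exact hball (by rwa [Metric.mem_ball, Real.dist_eq]) hj'
        have hsgn : SignType.sign (y - ρ j) = SignType.sign (x - ρ j) := by
          rcases le_abs.1 hjb with h' | h'
          · rw [sign_neg (by linarith), sign_neg (by linarith)]
          · rw [sign_pos (by linarith), sign_pos (by linarith)]
        simp [hsgn]
    · intro hi'
      exact absurd (Finsupp.notMem_support_iff.1 hi') hi
  ext (_ | i)
  · obtain ⟨x, hx⟩ := hD.nonempty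
    have key := h x hx
    rw [Finset.sum_eq_single none] at key
    · simpa using key
    · rintro (_ | i) _ hne
      · exact absurd rfl hne
      · rw [hsome, mul_zero]
    · intro h'
      rw [Finsupp.notMem_support_iff.1 h', mul_zero]
  · exact hsome i

theorem dense_transcendental : Dense {x : ℝ | Transcendental ℚ x} :=
  Set.Countable.dense_compl ℝ (Algebraic.countable ℚ ℝ)

theorem ofReal_sub_I_ne_zero (x : ℝ) : (x - Complex.I : ℂ) ≠ 0 := fun h => by
  simpa using congrArg Complex.im h

/-- The point `(x + i) / (x - i)` of the unit circle, at which the parameter `s` has the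
value `x`. -/
def circlePoint (x : ℝ) : Circle := Circle.ofConjDivSelf (x - Complex.I) (ofReal_sub_I_ne_zero x)

theorem coe_circlePoint (x : ℝ) :
    (circlePoint x : ℂ) = (x + Complex.I) / (x - Complex.I) := by
  change (starRingEnd ℂ) (x - Complex.I) / _ = _
  simp

theorem circlePoint_ne_one (x : ℝ) : (circlePoint x : ℂ) - 1 ≠ 0 := by
  rw [coe_circlePoint, div_sub_one (ofReal_sub_I_ne_zero x)]
  refine div_ne_zero ?_ (ofReal_sub_I_ne_zero x)
  ring_nf
  simp

theorem cayley_circlePoint (x : ℝ) :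
    Complex.I * ((circlePoint x : ℂ) + 1) / ((circlePoint x : ℂ) - 1) = x := by
  rw [div_eq_iff (circlePoint_ne_one x), coe_circlePoint]
  have := ofReal_sub_I_ne_zero x
  field_simp
  ring

theorem transcendental_circlePoint {x : ℝ} (hx : Transcendental ℚ x) :
    Transcendental ℚ (circlePoint x : ℂ) := by
  intro hz
  have hI : IsAlgebraic ℚ Complex.I := Complex.isIntegral_rat_I.isAlgebraic
  have h := (hI.mul (hz.add isAlgebraic_one)).mul (hz.sub isAlgebraic_one).inv
  rw [← div_eq_mul_inv, cayley_circlePoint] at h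
  exact hx ((isAlgebraic_algebraMap_iff (algebraMap ℝ ℂ).injective).1 h)

theorem evalHom_cayleySub {x : ℝ} (hz : Transcendental ℚ (circlePoint x : ℂ))
    (r : selfAdjoint Qbar) :
    evalHom (circlePoint x) hz (cayleySub r) = ((x - ((r : Qbar) : ℂ).re : ℝ) : ℂ) := by
  have hr : (((r : Qbar) : ℂ).re : ℂ) = ((r : Qbar) : ℂ) :=
    Complex.conj_eq_iff_re.1 (congrArg Subtype.val r.2.star_eq)
  rw [cayleySub, cayley]
  simp only [map_sub, map_div₀, map_mul, map_add, map_one, evalHom_C, evalHom_X]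
  rw [Complex.ofReal_sub, hr]
  congr 1
  exact cayley_circlePoint x

theorem specialize_diag (z : Circle) (hz : Transcendental ℚ (z : ℂ)) {f : RatFunc Qbar}
    (h0 : f ≠ 0) (hs : star f = f) :
    specialize z hz (L0.diag f) = L0.diag (evalHom z hz f) := by
  let : Algebra (RatFunc Qbar) ℂ := (evalHom z hz).toAlgebra
  have : StarModule (RatFunc Qbar) ℂ := ⟨fun f w => by
    change star (evalHom z hz f * w) = evalHom z hz (star f) * star w
    rw [evalHom_star, star_mul']⟩
  exact L0.baseChange_diag ℂ h0 hs

/-- The signature of `τ(z)`, as a homomorphism to `ℚ`. -/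
def signatureAt (z : Circle) (hz : Transcendental ℚ (z : ℂ)) : L0Q (RatFunc Qbar) →ₗ[ℤ] ℚ :=
  (TensorProduct.lid ℤ ℚ).toLinearMap ∘ₗ L0.signatureHom.toIntLinearMap.rTensor ℚ ∘ₗ
    (specialize z hz).toIntLinearMap.rTensor ℚ

theorem signatureAt_eq_zero {z : Circle} {hz : Transcendental ℚ (z : ℂ)}
    {τ : L0Q (RatFunc Qbar)} (h : value z hz τ = 0) : signatureAt z hz τ = 0 := by
  change TensorProduct.lid ℤ ℚ (L0.signatureHom.toIntLinearMap.rTensor ℚ (value z hz τ)) = 0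
  rw [h, map_zero, map_zero]

theorem signatureAt_tmul (z : Circle) (hz : Transcendental ℚ (z : ℂ)) {f : RatFunc Qbar}
    (h0 : f ≠ 0) (hs : star f = f) (q : ℚ) :
    signatureAt z hz (L0.diag f ⊗ₜ q) = (SignType.sign (evalHom z hz f).re : ℚ) * q := by
  change (L0.signatureHom (specialize z hz (L0.diag f))) • q = _
  rw [specialize_diag z hz h0 hs, L0.signatureHom_diag ((map_ne_zero _).2 h0)
    (by rw [← evalHom_star, hs]), zsmul_eq_mul]
  simp

/-- The generators `1` and `s - r`. -/
def generator (o : Option (selfAdjoint Qbar)) : RatFunc Qbar := o.elim 1 cayleySub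

theorem generator_ne_zero (o : Option (selfAdjoint Qbar)) : generator o ≠ 0 := by
  rcases o with _ | r
  · exact one_ne_zero
  · exact cayleySub_ne_zero r

theorem star_generator (o : Option (selfAdjoint Qbar)) : star (generator o) = generator o := by
  rcases o with _ | r
  · exact star_one _
  · exact star_cayleySub r

theorem sign_generator {x : ℝ} (hz : Transcendental ℚ (circlePoint x : ℂ))
    (o : Option (selfAdjoint Qbar)) :
    SignType.sign (evalHom (circlePoint x) hz (generator o)).re
      = o.elim 1 fun r => SignType.sign (x - ((r : Qbar) : ℂ).re) := by
  rcases o with _ | r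
  · simp [generator]
  · change SignType.sign (evalHom _ hz (cayleySub r)).re = _
    rw [evalHom_cayleySub, Complex.ofReal_re]
    rfl

theorem exists_eq_sum_generator (τ : L0Q (RatFunc Qbar)) :
    ∃ c : Option (selfAdjoint Qbar) →₀ ℚ,
      τ = ∑ o ∈ c.support, L0.diag (generator o) ⊗ₜ[ℤ] c o := by
  let Φ : (Option (selfAdjoint Qbar) →₀ ℚ) →+ L0Q (RatFunc Qbar) :=
    Finsupp.liftAddHom fun o =>
      (TensorProduct.mk ℤ (L0 (RatFunc Qbar)) ℚ (L0.diag (generator o))).toAddMonoidHom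
  have hsingle : ∀ o q, L0.diag (generator o) ⊗ₜ[ℤ] q ∈ Φ.range := fun o q =>
    ⟨Finsupp.single o q, by simp [Φ]⟩
  suffices h : τ ∈ Φ.range by
    obtain ⟨c, rfl⟩ := h
    exact ⟨c, rfl⟩
  induction τ using TensorProduct.induction_on with
  | zero => exact zero_mem _
  | add x y hx hy => exact add_mem hx hy
  | tmul x q =>
    have hx : x ∈ generatedSubgroup := generatedSubgroup_eq_top ▸ AddSubgroup.mem_top x
    induction hx using AddSubgroup.closure_induction with
    | mem x hx =>
      rcases hx with rfl | ⟨r, rfl⟩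
      · exact hsingle none q
      · exact hsingle (some r) q
    | zero =>
      rw [TensorProduct.zero_tmul]
      exact zero_mem _
    | add x y _ _ hx hy =>
      rw [TensorProduct.add_tmul]
      exact add_mem hx hy
    | neg x _ hx =>
      rw [TensorProduct.neg_tmul]
      exact neg_mem hx

end HermWitt

end

theorem mainTheorem3 (τ : HermWitt.L0Q (RatFunc HermWitt.Qbar)) :
    τ = 0 ↔ ∀ (z : Circle) (hz : Transcendental ℚ (z : ℂ)), HermWitt.value z hz τ = 0 := by
  constructor
  · rintro rfl z hz
    exact map_zero ((HermWitt.specialize z hz).toIntLinearMap.rTensor ℚ)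
  · intro h
    obtain ⟨c, rfl⟩ := HermWitt.exists_eq_sum_generator τ
    have hρ : Function.Injective fun r : selfAdjoint HermWitt.Qbar =>
        ((r : HermWitt.Qbar) : ℂ).re := by
      intro r r' hrr
      have him (r : selfAdjoint HermWitt.Qbar) : ((r : HermWitt.Qbar) : ℂ).im = 0 :=
        Complex.conj_eq_iff_im.1 (congrArg Subtype.val r.2.star_eq)
      exact Subtype.ext (Subtype.ext (Complex.ext hrr ((him r).trans (him r').symm)))
    have hc : c = 0 := by
      refine HermWitt.eq_zero_of_sum_sign_eq_zero hρ HermWitt.dense_transcendental c ?_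
      intro x hx
      have hz := HermWitt.transcendental_circlePoint hx
      have key := HermWitt.signatureAt_eq_zero (h _ hz)
      rw [map_sum] at key
      rw [← key]
      refine Finset.sum_congr rfl fun o _ => ?_
      rw [HermWitt.signatureAt_tmul _ hz (HermWitt.generator_ne_zero o)
        (HermWitt.star_generator o), HermWitt.sign_generator]
    rw [hc]
    simp
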